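/- All topological groups are assumed Hausdorff. A continuous map is called perfect if it is closed, onto, and all its fibers are compact. A topological group $G$ is called $P\mathcal{M}$-factorizable if for every continuous function $f:G\to\mathbb{R}$ there exist a metrizable topological group $H$, a perfect homomorphism $\pi:G\to H$ (in particular, $\pi$ is onto) and a continuous function $g:H\to\mathbb{R}$ such that $f=g\circ\pi$. A topological space $X$ is called pseudo-$\aleph_1$-compact if every discrete family of open subsets of $X$ is countable, where a family of subsets of $X$ is discrete if every point of $X$ has a neighbourhood that meets at most one member of the family. Theorem. Let $G$ be a $P\mathcal{M}$-factorizable topological group and let $K$ be a compact topological group. Then the product group $G\times K$ is $P\mathcal{M}$-factorizable if and only if at least one of the following conditions holds: (1) $K$ is metrizable; (2) $G$ is pseudo-$\aleph_1$-compact. -/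

import Mathlib

open Topology

/-- A continuous map is *perfect* if it is closed, onto, and all its fibers are compact. -/
structure IsPerfectMap {X Y : Type*} [TopologicalSpace X] [TopologicalSpace Y]
    (f : X → Y) : Prop where
  continuous : Continuous f
  isClosedMap : IsClosedMap f
  surjective : Function.Surjective f
  isCompact_fiber : ∀ y : Y, IsCompact (f ⁻¹' {y})

/-- A topological group `G` is *PM-factorizable* if every continuous real-valued function on `G`
factors, through a continuous real-valued function, over a perfect homomorphism of `G` onto a
metrizable topological group. As the homomorphism is onto, restricting `H` to the
universe of `G` loses nothing. -/
def IsPMFactorizable.{u} (G : Type u) [Group G] [TopologicalSpace G] : Prop :=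
  ∀ f : G → ℝ, Continuous f →
    ∃ (H : Type u) (_ : Group H) (_ : TopologicalSpace H) (_ : IsTopologicalGroup H)
      (_ : TopologicalSpace.MetrizableSpace H) (π : G →* H) (g : H → ℝ),
      IsPerfectMap π ∧ Continuous g ∧ f = g ∘ π

/-- A family of subsets of `X` is *discrete* if every point of `X` has a neighbourhood that
meets at most one member of the family. -/
def IsDiscreteFamily {X : Type*} [TopologicalSpace X] (𝒰 : Set (Set X)) : Prop :=
  ∀ x : X, ∃ V ∈ 𝓝 x, {U ∈ 𝒰 | (U ∩ V).Nonempty}.Subsingleton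

/-- A space is *pseudo-ℵ₁-compact* if every discrete family of open subsets is countable. -/
def IsPseudoAlephOneCompact (X : Type*) [TopologicalSpace X] : Prop :=
  ∀ 𝒰 : Set (Set X), (∀ U ∈ 𝒰, IsOpen U) → IsDiscreteFamily 𝒰 → 𝒰.Countable

open TopologicalSpace Set

/-! Read `f` on `G × K` as a map `F : G → C(K, ℝ)`. If `K` is metrizable, the slices of `f` over a
countable dense subset of `K` determine `f`, and `exists_common` factors them over one `π`. If `G`
is pseudo-`ℵ₁`-compact, `F` has separable range, so `f` descends to `G × K ⧸ N` with `K ⧸ N`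
metrizable: the first case again. If both conditions fail, `C(K, ℝ)` contains an uncountable
`ε`-separated set, and bumps on a discrete family in `G` make uncountably many of its members slices
of one `f`. A factorization of `f` would put all slices in a separable set. -/

theorem IsPerfectMap.isProperMap {X Y : Type*} [TopologicalSpace X] [TopologicalSpace Y]
    {f : X → Y} (hf : IsPerfectMap f) : IsProperMap f :=
  isProperMap_iff_isClosedMap_and_compact_fibers.2
    ⟨hf.continuous, hf.isClosedMap, hf.isCompact_fiber⟩

theorem IsProperMap.isPerfectMap {X Y : Type*} [TopologicalSpace X] [TopologicalSpace Y]
    {f : X → Y} (hf : IsProperMap f) (hs : Function.Surjective f) : IsPerfectMap f :=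
  ⟨hf.continuous, hf.isClosedMap, hs, fun _ => hf.isCompact_preimage isCompact_singleton⟩

theorem IsPerfectMap.isQuotientMap {X Y : Type*} [TopologicalSpace X] [TopologicalSpace Y]
    {f : X → Y} (hf : IsPerfectMap f) : IsQuotientMap f :=
  hf.isClosedMap.isQuotientMap hf.continuous hf.surjective

/-- A function constant on the fibres of a quotient map factors through it. -/
theorem Topology.IsQuotientMap.exists_continuous_factor {X Y Z : Type*} [TopologicalSpace X]
    [TopologicalSpace Y] [TopologicalSpace Z] {p : X → Y} (hp : IsQuotientMap p) {f : X → Z}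
    (hf : Continuous f) (h : ∀ x y, p x = p y → f x = f y) :
    ∃ g : Y → Z, Continuous g ∧ f = g ∘ p := by
  have hfg : f = (fun y => f (Function.surjInv hp.surjective y)) ∘ p :=
    funext fun x => h _ _ (Function.surjInv_eq hp.surjective (p x)).symm
  exact ⟨_, hp.continuous_iff.2 (hfg ▸ hf), hfg⟩

/-- In a non-separable subset of a metric space there is an uncountable uniformly discrete set. -/
theorem exists_uncountable_separated {X : Type*} [PseudoMetricSpace X] {T : Set X}
    (hT : ¬ IsSeparable T) :
    ∃ ε > 0, ∃ S ⊆ T, ¬ S.Countable ∧ S.Pairwise fun x y => ε ≤ dist x y := by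
  by_contra! h
  refine hT ?_
  obtain ⟨t, -, ht, hTt⟩ := UniformSpace.subset_countable_closure_of_almost_dense_set T
    (fun U hU => by
      obtain ⟨ε, hε, hεU⟩ := Metric.mem_uniformity_dist.1 hU
      -- A maximal `ε`-separated set is countable by assumption and `ε`-dense by maximality.
      obtain ⟨M, hM⟩ := zorn_subset {S | S ⊆ T ∧ S.Pairwise fun x y => ε ≤ dist x y}
        (fun c hc hchain => ⟨⋃₀ c, ⟨sUnion_subset fun s hs => (hc hs).1,
          (pairwise_sUnion hchain.directedOn).2 fun s hs => (hc hs).2⟩,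
          fun s hs => subset_sUnion_of_mem hs⟩)
      have hMc : M.Countable := by
        by_contra hMc
        exact h ε hε M hM.prop.1 hMc hM.prop.2
      refine ⟨M, hMc, fun x hx => ?_⟩
      by_contra hxM
      simp only [mem_iUnion, not_exists] at hxM
      have hfar : ∀ y ∈ M, ε ≤ dist x y := fun y hy => by
        by_contra! hlt
        exact hxM y hy (hεU (by rwa [dist_comm]))
      have hins : insert x M ∈ {S | S ⊆ T ∧ S.Pairwise fun x y => ε ≤ dist x y} := by
        refine ⟨insert_subset hx hM.prop.1, hM.prop.2.insert fun y hy _ => ⟨hfar y hy, ?_⟩⟩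
        rw [dist_comm]
        exact hfar y hy
      have hxM' := hM.le_of_ge hins (subset_insert x M) (mem_insert x M)
      have := hfar x hxM'
      rw [dist_self] at this
      exact absurd hε (not_lt.2 this))
  exact ⟨t, ht, hTt⟩

/-- A uniformly discrete separable set is countable. -/
theorem TopologicalSpace.IsSeparable.countable_of_separated {X : Type*} [PseudoMetricSpace X]
    {S : Set X} (hS : IsSeparable S) {ε : ℝ} (hε : 0 < ε)
    (h : S.Pairwise fun x y => ε ≤ dist x y) : S.Countable := by
  have hsep : SeparableSpace S := hS.separableSpace
  have : DiscreteTopology S := DiscreteTopology.of_forall_le_dist hε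
    fun x y hxy => h x.2 y.2 (Subtype.coe_injective.ne hxy)
  exact countable_coe_iff.1 (separableSpace_iff_countable.1 hsep)

/-- Continuous images of pseudo-`ℵ₁`-compact spaces in metric spaces are separable. -/
theorem IsPseudoAlephOneCompact.isSeparable_range {X Y : Type*} [TopologicalSpace X]
    [PseudoMetricSpace Y] (hX : IsPseudoAlephOneCompact X) {F : X → Y} (hF : Continuous F) :
    IsSeparable (range F) := by
  by_contra hsep
  obtain ⟨ε, hε, S, hST, hS, hdist⟩ := exists_uncountable_separated hsep
  refine hS ?_
  -- The path `s, z, w, z', s'` has four legs, each shorter than `ε / 4`.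
  have hdisc : ∀ s ∈ S, ∀ s' ∈ S, ∀ z z' w : Y, dist z s < ε / 4 → dist z' s' < ε / 4 →
      dist z w < ε / 4 → dist z' w < ε / 4 → s = s' := by
    intro s hs s' hs' z z' w h1 h2 h3 h4
    by_contra hne
    have h5 := hdist hs hs' hne
    have h6 := dist_triangle4 s z z' s'
    have h7 := dist_triangle_right z z' w
    rw [dist_comm s z] at h6
    linarith
  have hinj : InjOn (fun s => F ⁻¹' Metric.ball s (ε / 4)) S := by
    intro s hs s' hs' heq
    obtain ⟨x, rfl⟩ := hST hs
    have hx : x ∈ F ⁻¹' Metric.ball (F x) (ε / 4) := by simp [hε]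
    have hx' : x ∈ F ⁻¹' Metric.ball s' (ε / 4) := (Set.ext_iff.1 heq x).1 hx
    exact hdisc _ hs _ hs' (F x) (F x) (F x) hx hx' hx hx
  refine countable_of_injective_of_countable_image hinj (hX _ ?_ ?_)
  · rintro _ ⟨s, -, rfl⟩
    exact Metric.isOpen_ball.preimage hF
  · intro x
    refine ⟨F ⁻¹' Metric.ball (F x) (ε / 4),
      (Metric.isOpen_ball.preimage hF).mem_nhds (by simp [hε]), ?_⟩
    rintro _ ⟨⟨s, hs, rfl⟩, y, hy, hyx⟩ _ ⟨⟨s', hs', rfl⟩, y', hy', hyx'⟩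
    rw [hdisc s hs s' hs' _ _ _ hy hy' hyx hyx']

/-- Functions not separating two given points form a closed set, so by Urysohn a dense sequence
separates points. -/
theorem metrizableSpace_of_separableSpace_continuousMap {K : Type*} [TopologicalSpace K]
    [CompactSpace K] [T2Space K] [SeparableSpace C(K, ℝ)] : MetrizableSpace K := by
  refine Metric.PiNatEmbed.TopologicalSpace.MetrizableSpace.of_countable_separating
    (fun n => (denseSeq C(K, ℝ) n : K → ℝ)) (fun n => map_continuous _) fun x y hxy => ?_
  by_contra! h
  obtain ⟨f, hf0, hf1, -⟩ := exists_continuous_zero_one_of_isClosed (isClosed_singleton (x := x))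
    (isClosed_singleton (x := y)) (disjoint_singleton.2 hxy)
  have heq : ∀ g : C(K, ℝ), g x = g y := fun g =>
    (isClosed_eq (ContinuousEvalConst.continuous_eval_const x)
      (ContinuousEvalConst.continuous_eval_const y)).closure_subset_iff.2
      (range_subset_iff.2 h) (denseRange_denseSeq C(K, ℝ) g)
  have := heq f
  rw [hf0 rfl, hf1 rfl] at this
  exact zero_ne_one this

/-- Countably many continuous functions on a PM-factorizable group factor simultaneously. -/
theorem IsPMFactorizable.exists_common.{u} {G : Type u} [Group G] [TopologicalSpace G]
    (hG : IsPMFactorizable G) (f : ℕ → G → ℝ) (hf : ∀ n, Continuous (f n)) :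
    ∃ (H : Type u) (_ : Group H) (_ : TopologicalSpace H) (_ : IsTopologicalGroup H)
      (_ : MetrizableSpace H) (π : G →* H),
      IsPerfectMap π ∧ ∀ n x y, π x = π y → f n x = f n y := by
  choose H i₁ i₂ i₃ i₄ π g hπ _ hfg using fun n => hG (f n) (hf n)
  let φ : G →* (∀ n, H n) := MonoidHom.pi π
  have hφc : Continuous φ := continuous_pi fun n => (hπ n).continuous
  have : MetrizableSpace (∀ n, H n) := by
    let (n : ℕ) : MetricSpace (H n) := metrizableSpaceMetric (H n)
    have : PseudoMetrizableSpace (∀ n, H n) := UniformSpace.pseudoMetrizableSpace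
    infer_instance
  have : MetrizableSpace φ.range := IsEmbedding.subtypeVal.metrizableSpace
  -- One coordinate suffices: followed by the projection to `H 0`, this map is the proper map `π 0`.
  have hφ : IsProperMap φ.rangeRestrict :=
    isProperMap_of_comp_of_t2 (g := fun y : φ.range => y.1 0)
      (hφc.subtype_mk _) ((continuous_apply 0).comp continuous_subtype_val) (hπ 0).isProperMap
  refine ⟨φ.range, inferInstance, inferInstance, inferInstance, inferInstance, φ.rangeRestrict,
    hφ.isPerfectMap φ.rangeRestrict_surjective, fun n x y hxy => ?_⟩
  have : π n x = π n y := congrFun (congrArg Subtype.val hxy) n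
  simp [hfg, this]

theorem IsPMFactorizable.prod_of_metrizable {G K : Type*}
    [Group G] [TopologicalSpace G]
    [Group K] [TopologicalSpace K] [IsTopologicalGroup K] [CompactSpace K] [MetrizableSpace K]
    (hG : IsPMFactorizable G) : IsPMFactorizable (G × K) := by
  intro f hf
  have : SeparableSpace K := by
    let := metrizableSpaceMetric K
    infer_instance
  obtain ⟨H, _, _, _, _, π, hπ, hfac⟩ := hG.exists_common (fun n x => f (x, denseSeq K n))
    fun n => hf.comp (by fun_prop)
  have hp : IsPerfectMap (π.prodMap (MonoidHom.id K)) :=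
    (hπ.isProperMap.prodMap isProperMap_id).isPerfectMap
      (hπ.surjective.prodMap Function.surjective_id)
  obtain ⟨g, hg, hfg⟩ := hp.isQuotientMap.exists_continuous_factor hf (by
    rintro ⟨x, k⟩ ⟨y, l⟩ h
    obtain ⟨h1, rfl : k = l⟩ := Prod.ext_iff.1 h
    have : (fun k => f (x, k)) = fun k => f (y, k) :=
      (denseRange_denseSeq K).equalizer (by fun_prop) (by fun_prop)
        (funext fun n => hfac n x y h1)
    exact congrFun this k)
  exact ⟨H × K, inferInstance, inferInstance, inferInstance, inferInstance, _, g, hp, hg, hfg⟩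

/-- The normal subgroup of elements `k` such that `a * k * b` and `a * b` are never separated by
any of the functions `φ i`. -/
def inseparableSubgroup {ι K Z : Type*} [Group K] (φ : ι → K → Z) : Subgroup K where
  carrier := {k | ∀ i a b, φ i (a * k * b) = φ i (a * b)}
  one_mem' := by simp
  mul_mem' {k l} hk hl i a b := by
    rw [← mul_assoc, hl, hk]
  inv_mem' {k} hk i a b := by
    have := hk i (a * k⁻¹) b
    rw [inv_mul_cancel_right] at this
    exact this.symm

instance inseparableSubgroup_normal {ι K Z : Type*} [Group K] (φ : ι → K → Z) :
    (inseparableSubgroup φ).Normal where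
  conj_mem k hk c i a b := by
    have := hk i (a * c) (c⁻¹ * b)
    simpa [mul_assoc] using this

/-- The cosets are the joint fibres of the maps `k ↦ ((a, b) ↦ φ n (a * k * b))` into `C(K × K, ℝ)`,
so countably many continuous maps to a metric space separate the points of the compact quotient. -/
theorem metrizableSpace_quotient_inseparableSubgroup {K : Type*} [Group K] [TopologicalSpace K]
    [IsTopologicalGroup K] [CompactSpace K] (φ : ℕ → C(K, ℝ)) :
    MetrizableSpace (K ⧸ inseparableSubgroup fun n => (φ n : K → ℝ)) := by
  set N := inseparableSubgroup fun n => (φ n : K → ℝ)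
  let T : ℕ → K → C(K × K, ℝ) := fun n =>
    ContinuousMap.curry ⟨fun p : K × K × K => φ n (p.2.1 * p.1 * p.2.2), by fun_prop⟩
  have hT : ∀ n, Continuous (T n) := fun n => map_continuous _
  have hN : ∀ k l : K, (k : K ⧸ N) = l ↔ ∀ n, T n k = T n l := by
    intro k l
    rw [QuotientGroup.eq]
    constructor
    · intro h n
      ext ⟨a, b⟩
      have := h n (a * k) b
      simpa [T, mul_assoc] using this.symm
    · intro h n a b
      have := DFunLike.congr_fun (h n) (a * k⁻¹, b)
      simpa [T, mul_assoc] using this.symm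
  refine Metric.PiNatEmbed.TopologicalSpace.MetrizableSpace.of_countable_separating
    (fun n => Quotient.lift (T n) fun k l h => (hN k l).1 (Quotient.sound h) n)
    (fun n => (hT n).quotient_lift _) ?_
  intro x y
  induction x using QuotientGroup.induction_on with | _ k
  induction y using QuotientGroup.induction_on with | _ l
  intro hne
  by_contra! h
  exact hne ((hN k l).2 h)

theorem IsPMFactorizable.prod_of_isPseudoAlephOneCompact {G K : Type*}
    [Group G] [TopologicalSpace G]
    [Group K] [TopologicalSpace K] [IsTopologicalGroup K] [CompactSpace K]
    (hG : IsPMFactorizable G) (hps : IsPseudoAlephOneCompact G) : IsPMFactorizable (G × K) := by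
  intro f hf
  let F : C(G, C(K, ℝ)) := ContinuousMap.curry ⟨f, hf⟩
  have hsep : IsSeparable (range F) := hps.isSeparable_range (map_continuous F)
  obtain ⟨t, htc, ht⟩ := hsep
  have htne : t.Nonempty := closure_nonempty_iff.1 ((range_nonempty F).mono ht)
  obtain ⟨φ, rfl⟩ := htc.exists_eq_range htne
  set N := inseparableSubgroup fun n => (φ n : K → ℝ)
  have : MetrizableSpace (K ⧸ N) := metrizableSpace_quotient_inseparableSubgroup φ
  have hinv : ∀ (x : G) (k l : K), (k : K ⧸ N) = l → f (x, k) = f (x, l) := by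
    intro x k l hkl
    have hmem : k⁻¹ * l ∈ N := QuotientGroup.eq.1 hkl
    have hφ : ∀ n, φ n k = φ n l := fun n => by
      simpa using (hmem n k 1).symm
    -- Agreement at `k` and `l` is a closed condition, and `F x` is a limit of the `φ n`.
    exact (isClosed_eq (ContinuousEvalConst.continuous_eval_const k)
      (ContinuousEvalConst.continuous_eval_const l)).closure_subset_iff.2
      (range_subset_iff.2 hφ) (ht (mem_range_self x))
  have hq : IsPerfectMap ((MonoidHom.id G).prodMap (QuotientGroup.mk' N)) :=
    (isProperMap_id.prodMap (QuotientGroup.continuous_mk (N := N)).isProperMap).isPerfectMap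
      (Function.surjective_id.prodMap (QuotientGroup.mk'_surjective N))
  obtain ⟨f', hf', hff'⟩ := hq.isQuotientMap.exists_continuous_factor hf (by
    rintro ⟨x, k⟩ ⟨y, l⟩ h
    obtain ⟨rfl : x = y, h2⟩ := Prod.ext_iff.1 h
    exact hinv x k l h2)
  obtain ⟨H, i₁, i₂, i₃, i₄, π, g, hπ, hg, hfg⟩ := hG.prod_of_metrizable (K := K ⧸ N) f' hf'
  refine ⟨H, i₁, i₂, i₃, i₄, π.comp ((MonoidHom.id G).prodMap (QuotientGroup.mk' N)), g, ?_, hg, ?_⟩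
  · exact (hπ.isProperMap.comp hq.isProperMap).isPerfectMap (hπ.surjective.comp hq.surjective)
  · rw [hff', hfg]
    rfl

/-- From an uncountable type there is a map into a given uncountable set with uncountable range. -/
theorem exists_uncountable_range {A X : Type*} (hA : Uncountable A) {S : Set X}
    (hS : ¬ S.Countable) : ∃ φ : A → X, range φ ⊆ S ∧ ¬ (range φ).Countable := by
  rcases Function.Embedding.total A S with ⟨⟨e, he⟩⟩ | ⟨⟨e, he⟩⟩
  · refine ⟨fun a => e a, range_subset_iff.2 fun a => (e a).2, fun hc => ?_⟩
    have := hc.to_subtype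
    have hinj : Function.Injective (rangeFactorization fun a => (e a : X)) :=
      rangeFactorization_injective.2 (Subtype.val_injective.comp he)
    exact not_countable_iff.2 hA hinj.countable
  · obtain ⟨s₀, hs₀⟩ : S.Nonempty := nonempty_iff_ne_empty.2 fun h => hS (by simp [h])
    have : Nonempty S := ⟨⟨s₀, hs₀⟩⟩
    refine ⟨fun a => (Function.invFun e a : S), range_subset_iff.2 fun a => Subtype.coe_prop _,
      fun hc => hS (hc.mono fun s hs => mem_range.2 ⟨e ⟨s, hs⟩, ?_⟩)⟩
    simp [Function.leftInverse_invFun he ⟨s, hs⟩]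

/-- Multiplying the members of a family of functions on `K` by bumps at points of the members of a
discrete family of open subsets of `G`, one obtains a single function on `G × K`. -/
theorem exists_continuous_prod_of_isDiscreteFamily {G K : Type*} [TopologicalSpace G]
    [CompletelyRegularSpace G] [TopologicalSpace K] {𝒰 : Set (Set G)} (hO : ∀ U ∈ 𝒰, IsOpen U)
    (hne : ∀ U ∈ 𝒰, U.Nonempty) (hd : IsDiscreteFamily 𝒰) (φ : 𝒰 → C(K, ℝ)) :
    ∃ (f : G × K → ℝ) (x : 𝒰 → G), Continuous f ∧ ∀ U k, f (x U, k) = φ U k := by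
  choose x hx using fun U : 𝒰 => hne U U.2
  choose h hc h0 h1 using fun U : 𝒰 =>
    CompletelyRegularSpace.completely_regular (x U) (U : Set G)ᶜ (hO U U.2).isClosed_compl
      (by simpa using hx U)
  -- `h U` is `0` at `x U` and `1` off `U`, so `1 - h U` is the bump.
  let F : 𝒰 → G × K → ℝ := fun U p => (1 - (h U p.1 : ℝ)) * φ U p.2
  have hF0 : ∀ (U : 𝒰) (p : G × K), p.1 ∉ (U : Set G) → F U p = 0 := fun U p hp => by
    simp [F, h1 U hp]
  refine ⟨fun p => ∑ᶠ U, F U p, x, continuous_finsum (fun U => ?_) ?_, fun U k => ?_⟩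
  · have := hc U
    fun_prop
  · rintro ⟨y, k⟩
    obtain ⟨V, hV, hsub⟩ := hd y
    refine ⟨V ×ˢ univ, prod_mem_nhds hV Filter.univ_mem, Set.Subsingleton.finite ?_⟩
    have key : ∀ U : 𝒰, (Function.support (F U) ∩ V ×ˢ univ).Nonempty →
        (U : Set G) ∈ {U ∈ 𝒰 | (U ∩ V).Nonempty} := by
      rintro U ⟨p, hp, hpV, -⟩
      exact ⟨U.2, p.1, by_contra fun hn => hp (hF0 U p hn), hpV⟩
    exact fun U hU U' hU' => Subtype.ext (hsub (key U hU) (key U' hU'))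
  · show ∑ᶠ U', F U' (x U, k) = φ U k
    rw [finsum_eq_single _ U]
    · simp [F, h0]
    · intro U' hne'
      refine hF0 U' _ fun hmem => hne' (Subtype.ext ?_)
      obtain ⟨V, hV, hsub⟩ := hd (x U)
      exact hsub ⟨U'.2, x U, hmem, mem_of_mem_nhds hV⟩ ⟨U.2, x U, hx U, mem_of_mem_nhds hV⟩

theorem IsPMFactorizable.metrizable_or_isPseudoAlephOneCompact {G K : Type*}
    [Group G] [TopologicalSpace G] [IsTopologicalGroup G]
    [Group K] [TopologicalSpace K] [T2Space K] [CompactSpace K]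
    (h : IsPMFactorizable (G × K)) : MetrizableSpace K ∨ IsPseudoAlephOneCompact G := by
  by_contra! hcon
  obtain ⟨hK, hps⟩ := hcon
  have hsep : ¬ IsSeparable (univ : Set C(K, ℝ)) := fun hs => by
    have := isSeparable_univ_iff.1 hs
    exact hK metrizableSpace_of_separableSpace_continuousMap
  obtain ⟨ε, hε, S, -, hS, hdist⟩ := exists_uncountable_separated hsep
  simp only [IsPseudoAlephOneCompact, not_forall] at hps
  obtain ⟨𝒰, hO, hd, hunc⟩ := hps
  have hunc' : Uncountable ↥(𝒰 \ {∅}) := by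
    rw [← not_countable_iff, countable_coe_iff]
    exact fun hc => hunc ((hc.union (countable_singleton ∅)).mono (by simp))
  obtain ⟨φ, hφS, hφ⟩ := exists_uncountable_range hunc' hS
  have : CompletelyRegularSpace G := by
    let := IsTopologicalGroup.rightUniformSpace G
    infer_instance
  obtain ⟨f, x, hf, hfx⟩ := exists_continuous_prod_of_isDiscreteFamily
    (𝒰 := 𝒰 \ {∅}) (fun U hU => hO U hU.1) (fun U hU => nonempty_iff_ne_empty.2 hU.2)
    (fun y => (hd y).imp fun V hV => ⟨hV.1, hV.2.anti fun U hU => ⟨hU.1.1, hU.2⟩⟩) φ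
  obtain ⟨H, _, _, _, _, π, g, hπ, hg, rfl⟩ := h f hf
  -- The image of `K` in `H` is compact metrizable, so its function space is separable.
  let p : C(K, H) := ⟨fun k => π (1, k), hπ.continuous.comp (by fun_prop)⟩
  let q : C(K, range p) := ⟨rangeFactorization p, p.continuous.subtype_mk _⟩
  have : CompactSpace (range p) := isCompact_iff_compactSpace.1 (isCompact_range p.continuous)
  have : SeparableSpace C(range p, ℝ) := by
    let := metrizableSpaceMetric (range p)
    infer_instance
  have hR : IsSeparable (range fun ψ : C(range p, ℝ) => ψ.comp q) :=
    isSeparable_range (ContinuousMap.continuous_precomp q)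
  refine hφ ((hR.mono ?_).countable_of_separated hε (hdist.mono hφS))
  rintro _ ⟨U, rfl⟩
  -- Since `π (x, k) = π (x, 1) * π (1, k)`, every slice of `f` factors through `q`.
  refine ⟨⟨fun l => g (π (x U, 1) * l), hg.comp (by fun_prop)⟩, ?_⟩
  ext k
  rw [← hfx U k]
  show g (π (x U, 1) * π (1, k)) = g (π (x U, k))
  rw [← map_mul]
  simp

theorem theorem4p14 {G K : Type*}
    [Group G] [TopologicalSpace G] [IsTopologicalGroup G] [T2Space G]
    [Group K] [TopologicalSpace K] [IsTopologicalGroup K] [T2Space K] [CompactSpace K]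
    (hG : IsPMFactorizable G) :
    IsPMFactorizable (G × K) ↔
      (TopologicalSpace.MetrizableSpace K ∨ IsPseudoAlephOneCompact G) := by
  refine ⟨fun h => h.metrizable_or_isPseudoAlephOneCompact, ?_⟩
  rintro (_ | hps)
  · exact hG.prod_of_metrizable
  · exact hG.prod_of_isPseudoAlephOneCompact hps
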